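/- Let $n\ge 1$ be an integer and let $p\in[1,\infty)$. For a Lebesgue measurable set $E\subset\mathbb{R}^n$ write $|E|$ for its Lebesgue measure and $$P(E):=\sup\Big\{\int_E \operatorname{div}V\,dx \;:\; V\in C^1_c(\mathbb{R}^n;\mathbb{R}^n),\ |V|\le 1\Big\}\in[0,\infty]$$ for its perimeter. For Lebesgue measurable sets $E,F\subset\mathbb{R}^n$ with $0<|E|=|F|<\infty$ let $$W_p(E,F):=\Big(\inf_{\gamma}\int_{\mathbb{R}^n\times\mathbb{R}^n}|x-y|^p\,d\gamma(x,y)\Big)^{1/p}\in[0,\infty],$$ where the infimum is over all finite positive Borel measures $\gamma$ on $\mathbb{R}^n\times\mathbb{R}^n$ whose first and second marginals are the restrictions of Lebesgue measure to $E$ and to $F$, respectively. (i) There exists a sequence $\{(E_m,F_m)\}_{m\in\mathbb{N}}$ of pairs of Lebesgue measurable subsets of $\mathbb{R}^n$ such that $|E_m\cap F_m|=0$ and $|E_m|=|F_m|=1$ for all $m$, and $W_p(E_m,F_m)\to 0$ as $m\to\infty$. (ii) For every sequence $\{(E_m,F_m)\}_{m\in\mathbb{N}}$ of pairs of Lebesgue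 measurable subsets of $\mathbb{R}^n$ with these properties, $P(E_m)\to\infty$ and $P(F_m)\to\infty$ as $m\to\infty$. -/

import Mathlib

open MeasureTheory Filter Topology
open scoped ENNReal

noncomputable section

namespace WassersteinPerimeter

/-- The divergence `∑ i, ∂ᵢ Vᵢ` of a vector field on `ℝⁿ`. -/
def divergence {n : ℕ} (V : EuclideanSpace ℝ (Fin n) → EuclideanSpace ℝ (Fin n))
    (x : EuclideanSpace ℝ (Fin n)) : ℝ :=
  ∑ i : Fin n, (fderiv ℝ V x (EuclideanSpace.single i 1)) i

/-- The De Giorgi perimeter of `E ⊆ ℝⁿ`, in `[0, ∞]`: the supremum of `∫_E div V` over the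
`C¹` vector fields `V` with compact support and `|V| ≤ 1` everywhere. Since `V = 0` is allowed,
the supremum is not changed by replacing negative values of the integral by `0`, which is what
`ENNReal.ofReal` does. -/
def perimeter {n : ℕ} (E : Set (EuclideanSpace ℝ (Fin n))) : ℝ≥0∞ :=
  ⨆ (V : EuclideanSpace ℝ (Fin n) → EuclideanSpace ℝ (Fin n))
    (_ : ContDiff ℝ 1 V ∧ HasCompactSupport V ∧ ∀ x, ‖V x‖ ≤ 1),
    ENNReal.ofReal (∫ x in E, divergence V x)

/-- The set `Π(μ, ν)` of couplings: finite Borel measures on the product with first marginal `μ`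
and second marginal `ν`. -/
def couplings {X : Type*} [MeasurableSpace X] (μ ν : Measure X) : Set (Measure (X × X)) :=
  {γ | IsFiniteMeasure γ ∧ γ.map Prod.fst = μ ∧ γ.map Prod.snd = ν}

/-- The value, in `[0, ∞]`, of Kantorovich's problem with cost `c`. -/
def kantorovich {X : Type*} [MeasurableSpace X] (c : X → X → ℝ≥0∞) (μ ν : Measure X) : ℝ≥0∞ :=
  ⨅ γ ∈ couplings μ ν, ∫⁻ z, c z.1 z.2 ∂γ

/-- The `p`-Wasserstein distance, in `[0, ∞]`, between two subsets of `ℝⁿ`: the `p`-th root of the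
value of Kantorovich's problem with cost `|x - y| ^ p` between the restrictions of Lebesgue
measure to the two sets. -/
def wassersteinDist {n : ℕ} (p : ℝ) (E F : Set (EuclideanSpace ℝ (Fin n))) : ℝ≥0∞ :=
  kantorovich (fun x y => ‖x - y‖ₑ ^ p) (volume.restrict E) (volume.restrict F) ^ (1 / p)

/-- Pairs of Lebesgue measurable sets with `|E ∩ F| = 0` and `|E| = |F| = 1`. -/
structure IsAdmissiblePair {n : ℕ} (E F : Set (EuclideanSpace ℝ (Fin n))) : Prop where
  /-- `E` is Lebesgue measurable. -/
  measurable_left : NullMeasurableSet E volume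
  /-- `F` is Lebesgue measurable. -/
  measurable_right : NullMeasurableSet F volume
  /-- `E` and `F` overlap only in a null set. -/
  inter_null : volume (E ∩ F) = 0
  /-- `E` has unit volume. -/
  volume_left : volume E = 1
  /-- `F` has unit volume. -/
  volume_right : volume F = 1

end WassersteinPerimeter

end

/-!
**Disjoint sets at small distance.** The slabs `[j / k, (j + 1) / k)` cut a box with one side of
length `2` and all others of length `1` into `2k` pieces. The even ones and the odd ones make up two
disjoint sets of volume `1` that differ by a translation of length `1 / k`, and this translation is
a coupling (`tendsto_wassersteinDist_stripes`).

**Small distance forces large perimeter.** For every `ε > 0` there is a constant `L` with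
`1 ≤ 2 ε P(E) + L W_p(E, F)` for all admissible pairs
(`exists_one_le_perimeter_add_wassersteinDist`), and divergence of the perimeters follows by taking
`ε` small compared with `1 / P(E)`. To see the inequality, mollify the indicator function of `E` by
a Lipschitz probability density supported in the ball of radius `ε`. The resulting function `Φ` is
Lipschitz with a constant that depends only on `ε` because `|E| = 1`, so for a coupling `γ` of `E`
and `F` the difference `∫_E Φ - ∫_F Φ = ∫ (Φ(x) - Φ(y)) dγ` is at most `L ∫ |x - y| dγ`, which
Jensen's inequality compares with the `p`-cost. On the other hand `∫ Φ = 1` while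
`∫_{Eᶜ} Φ ≤ ε P(E)` (`setLIntegral_compl_mollify_le`), and `F` lies in `Eᶜ` up to a null set.

The bound on `∫_{Eᶜ} Φ` is an average of the translation estimate `|E \ (E - h)| ≤ |h| P(E)`
(`volume_diff_translate_le`). That one is read off the definition of the perimeter: for `ψ` smooth
and close to the indicator function of `E`, the difference `ψ - ψ(· + h)` is the divergence of the
field `x ↦ -(∫₀¹ ψ(x + t h) dt) h`, whose length is at most `|h|`.
-/

namespace WassersteinPerimeter

open Set

/-! ### Translations and the perimeter -/

theorem ofReal_setIntegral_divergence_le {n : ℕ} (E : Set (EuclideanSpace ℝ (Fin n)))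
    {V : EuclideanSpace ℝ (Fin n) → EuclideanSpace ℝ (Fin n)} (hV : ContDiff ℝ 1 V)
    (hc : HasCompactSupport V) {C : ℝ} (hC : 0 < C) (hb : ∀ x, ‖V x‖ ≤ C) :
    ENNReal.ofReal (∫ x in E, divergence V x) ≤ ENNReal.ofReal C * perimeter E := by
  have hdiv : ∀ x, divergence V x = C * divergence (C⁻¹ • V) x := by
    intro x
    have : fderiv ℝ (C⁻¹ • V) x = C⁻¹ • fderiv ℝ V x :=
      fderiv_const_smul (hV.differentiable one_ne_zero x) _
    simp only [divergence, this, Finset.mul_sum]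
    refine Finset.sum_congr rfl fun i _ => ?_
    simp [hC.ne']
  simp_rw [hdiv, integral_const_mul]
  rw [ENNReal.ofReal_mul hC.le]
  gcongr
  refine le_iSup₂_of_le (C⁻¹ • V) ⟨hV.const_smul C⁻¹, hc.smul_left, fun x => ?_⟩ le_rfl
  rw [Pi.smul_apply, norm_smul, norm_inv, Real.norm_of_nonneg hC.le, inv_mul_le_one₀ hC]
  exact hb x

section Average

variable {G : Type*} [NormedAddCommGroup G] [NormedSpace ℝ G]

/-- The average of `ψ` over the segment from `x` to `x + h`. -/
noncomputable def segmentAverage (ψ : G → ℝ) (h x : G) : ℝ :=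
  ∫ t in (0 : ℝ)..1, ψ (x + t • h)

theorem hasFDerivAt_segmentAverage {ψ : G → ℝ} (hψ : ContDiff ℝ 1 ψ)
    (hc : HasCompactSupport ψ) (h x : G) :
    HasFDerivAt (segmentAverage ψ h) (∫ t in (0 : ℝ)..1, fderiv ℝ ψ (x + t • h)) x := by
  have hcont : Continuous (fderiv ℝ ψ) := hψ.continuous_fderiv one_ne_zero
  obtain ⟨C, hC⟩ := (hc.fderiv (𝕜 := ℝ)).exists_bound_of_continuous hcont
  refine intervalIntegral.hasFDerivAt_integral_of_dominated_of_fderiv_le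
    (F := fun x t => ψ (x + t • h)) (F' := fun x t => fderiv ℝ ψ (x + t • h))
    (bound := fun _ => C) univ_mem ?_ ?_ ?_ ?_ ?_ ?_
  · exact Eventually.of_forall fun y =>
      (hψ.continuous.comp (by fun_prop : Continuous fun t : ℝ => y + t • h)).aestronglyMeasurable
  · exact (hψ.continuous.comp (by fun_prop : Continuous fun t : ℝ => x + t • h)).intervalIntegrable
      _ _
  · exact (hcont.comp (by fun_prop : Continuous fun t : ℝ => x + t • h)).aestronglyMeasurable
  · exact Eventually.of_forall fun t _ y _ => hC _
  · exact intervalIntegrable_const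
  · refine Eventually.of_forall fun t _ y _ => ?_
    exact (hasFDerivAt_comp_add_right (t • h)).2
      (hψ.differentiable one_ne_zero (y + t • h)).hasFDerivAt

theorem contDiff_segmentAverage {ψ : G → ℝ} (hψ : ContDiff ℝ 1 ψ)
    (hc : HasCompactSupport ψ) (h : G) : ContDiff ℝ 1 (segmentAverage ψ h) := by
  refine contDiff_one_iff_hasFDerivAt.2 ⟨_, ?_, hasFDerivAt_segmentAverage hψ hc h⟩
  refine intervalIntegral.continuous_parametric_intervalIntegral_of_continuous' ?_ 0 1
  exact (hψ.continuous_fderiv one_ne_zero).comp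
    (by fun_prop : Continuous fun p : G × ℝ => p.1 + p.2 • h)

/-- The derivative of the average in the direction of the segment is the increment of `ψ` along it,
by the fundamental theorem of calculus. -/
theorem fderiv_segmentAverage_apply {ψ : G → ℝ} (hψ : ContDiff ℝ 1 ψ)
    (hc : HasCompactSupport ψ) (h x : G) :
    fderiv ℝ (segmentAverage ψ h) x h = ψ (x + h) - ψ x := by
  have hcont : Continuous fun t : ℝ => fderiv ℝ ψ (x + t • h) :=
    (hψ.continuous_fderiv one_ne_zero).comp (by fun_prop : Continuous fun t : ℝ => x + t • h)
  rw [(hasFDerivAt_segmentAverage hψ hc h x).fderiv,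
    ContinuousLinearMap.intervalIntegral_apply (hcont.intervalIntegrable _ _),
    intervalIntegral.integral_eq_sub_of_hasDerivAt (f := fun t : ℝ => ψ (x + t • h))]
  · simp
  · intro t _
    have h1 : HasDerivAt (fun t : ℝ => x + t • h) h t := by
      simpa using ((hasDerivAt_id t).smul_const h).const_add x
    exact (hψ.differentiable one_ne_zero (x + t • h)).hasFDerivAt.comp_hasDerivAt t h1
  · exact (hcont.clm_apply continuous_const).intervalIntegrable _ _

theorem hasCompactSupport_segmentAverage {ψ : G → ℝ} (hc : HasCompactSupport ψ) (h : G) :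
    HasCompactSupport (segmentAverage ψ h) := by
  -- The average vanishes off the image of `tsupport ψ × [0, 1]` under `(y, t) ↦ y - t • h`.
  refine HasCompactSupport.intro
    (K := (fun p : G × ℝ => p.1 - p.2 • h) '' (tsupport ψ ×ˢ Icc 0 1))
    ((hc.prod isCompact_Icc).image (by fun_prop)) fun x hx => ?_
  refine (intervalIntegral.integral_congr (g := fun _ => (0 : ℝ)) fun t ht => ?_).trans (by simp)
  by_contra h0
  rw [uIcc_of_le zero_le_one] at ht
  exact hx ⟨(x + t • h, t), ⟨subset_tsupport _ h0, ht⟩, by simp⟩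

theorem abs_segmentAverage_le {ψ : G → ℝ} (hb : ∀ x, |ψ x| ≤ 1) (h x : G) :
    |segmentAverage ψ h x| ≤ 1 := by
  simpa [segmentAverage] using intervalIntegral.norm_integral_le_of_norm_le_const (a := (0 : ℝ)) (b := 1)
    (f := fun t => ψ (x + t • h)) fun t _ => hb _

end Average

theorem divergence_smul_const {n : ℕ} {f : EuclideanSpace ℝ (Fin n) → ℝ}
    {x : EuclideanSpace ℝ (Fin n)} (hf : DifferentiableAt ℝ f x) (v : EuclideanSpace ℝ (Fin n)) :
    divergence (fun y => f y • v) x = fderiv ℝ f x v := by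
  have hv : v = ∑ i, v i • EuclideanSpace.single i (1 : ℝ) := by
    simpa using ((EuclideanSpace.basisFun (Fin n) ℝ).sum_repr v).symm
  conv_rhs => rw [hv]
  rw [divergence, fderiv_smul_const hf]
  simp [mul_comm]

/-- The smooth form of `‖1_E - 1_E(· + h)‖₁ ≤ 2 |h| P(E)`: the increment of `ψ` along `h` is the
divergence of the segment average of `ψ` times `h`, a field of length at most `|h|`. -/
theorem ofReal_setIntegral_sub_translate_le {n : ℕ} (E : Set (EuclideanSpace ℝ (Fin n)))
    {ψ : EuclideanSpace ℝ (Fin n) → ℝ} (hψ : ContDiff ℝ 1 ψ)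
    (hc : HasCompactSupport ψ) (hb : ∀ x, |ψ x| ≤ 1) (h : EuclideanSpace ℝ (Fin n)) :
    ENNReal.ofReal (∫ x in E, (ψ x - ψ (x + h))) ≤ ‖h‖ₑ * perimeter E := by
  rcases eq_or_ne h 0 with rfl | h0
  · simp
  rw [← ofReal_norm]
  have hA := contDiff_segmentAverage hψ hc h
  have hdiv : ∀ x, ψ x - ψ (x + h) = divergence (fun y => segmentAverage ψ h y • -h) x := by
    intro x
    rw [divergence_smul_const (hA.differentiable one_ne_zero x), map_neg,
      fderiv_segmentAverage_apply hψ hc, neg_sub]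
  simp_rw [hdiv]
  refine ofReal_setIntegral_divergence_le E (hA.smul contDiff_const)
    (hasCompactSupport_segmentAverage hc h).smul_right (norm_pos_iff.2 h0) fun x => ?_
  rw [Pi.smul_apply', norm_smul, norm_neg]
  exact mul_le_of_le_one_left (norm_nonneg _) (abs_segmentAverage_le hb h x)

open scoped ContDiff Manifold in
/-- Smooth Urysohn functions between a compact set and an open set. -/
theorem exists_contDiff_one_of_isCompact_subset_isOpen {G : Type*} [NormedAddCommGroup G]
    [NormedSpace ℝ G] [FiniteDimensional ℝ G] {K U : Set G} (hK : IsCompact K) (hU : IsOpen U)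
    (hKU : K ⊆ U) :
    ∃ ψ : G → ℝ, ContDiff ℝ 1 ψ ∧ HasCompactSupport ψ ∧ (∀ x, ψ x ∈ Icc (0 : ℝ) 1) ∧
      (∀ x ∈ K, ψ x = 1) ∧ ∀ x ∉ U, ψ x = 0 := by
  obtain ⟨L, hL, hKL, hLU⟩ := exists_compact_between hK hU hKU
  obtain ⟨f, hf0, hf1, hf⟩ := exists_contMDiffMap_zero_one_of_isClosed (n := 1) 𝓘(ℝ, G)
    (isOpen_interior (s := L)).isClosed_compl hK.isClosed
    (disjoint_compl_left_iff_subset.2 hKL)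
  refine ⟨f, f.contMDiff.contDiff, HasCompactSupport.intro hL fun x hx => ?_, hf,
    fun x hx => hf1 hx, fun x hx => ?_⟩
  · exact hf0 fun hx' => hx (interior_subset hx')
  · exact hf0 fun hx' => hx (hLU (interior_subset hx'))

/-- The part of `E` that a translation moves out of `E` has volume at most the length of the
translation times the perimeter. -/
theorem volume_diff_translate_le {n : ℕ} {E : Set (EuclideanSpace ℝ (Fin n))}
    (hE : MeasurableSet E) (hfin : volume E ≠ ∞) (h : EuclideanSpace ℝ (Fin n)) :
    volume (E \ (· + h) ⁻¹' E) ≤ ‖h‖ₑ * perimeter E := by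
  refine ENNReal.le_of_forall_pos_le_add fun δ hδ _ => ?_
  have hδ4 : ((δ / 4 : NNReal) : ℝ≥0∞) ≠ 0 := ENNReal.coe_ne_zero.2 (by positivity)
  obtain ⟨K, hKE, hK, hKδ⟩ := hE.exists_isCompact_sdiff_lt hfin hδ4
  obtain ⟨U, hEU, hU, hUfin, hUδ⟩ := hE.exists_isOpen_sdiff_lt hfin hδ4
  obtain ⟨ψ, hψ, hψc, hψ01, hψK, hψU⟩ :=
    exists_contDiff_one_of_isCompact_subset_isOpen hK hU (hKE.trans hEU)
  -- `ψ` agrees with the indicator of `E` off `D`.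
  set D := U \ K with hD
  set A := E \ (· + h) ⁻¹' E with hA
  have hDm : MeasurableSet D := hU.measurableSet.diff hK.measurableSet
  have hAm : MeasurableSet A := hE.diff (hE.preimage (measurable_add_const h))
  have hDδ : volume D ≤ (δ / 2 : NNReal) := by
    have hsub : D ⊆ (E \ K) ∪ (U \ E) := by
      intro x hx
      by_cases hxE : x ∈ E
      · exact Or.inl ⟨hxE, hx.2⟩
      · exact Or.inr ⟨hx.1, hxE⟩
    calc volume D ≤ volume (E \ K) + volume (U \ E) :=
          (measure_mono hsub).trans (measure_union_le _ _)
      _ ≤ (δ / 4 : NNReal) + (δ / 4 : NNReal) := add_le_add hKδ.le hUδ.le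
      _ = (δ / 2 : NNReal) := by
          rw [← ENNReal.coe_add, ← two_mul, mul_div_left_comm]
          norm_num [div_eq_mul_inv]
  have hDfin : volume D ≠ ∞ := ne_top_of_le_ne_top ENNReal.coe_ne_top hDδ
  have hDreal : volume.real D ≤ δ / 2 := by
    simpa [measureReal_def] using ENNReal.toReal_mono ENNReal.coe_ne_top hDδ
  have hint : Integrable ψ volume := hψ.continuous.integrable_of_hasCompactSupport hψc
  have hintA : Integrable (A.indicator (1 : EuclideanSpace ℝ (Fin n) → ℝ)) volume :=
    (integrable_indicator_iff hAm).2 (integrableOn_const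
      (ne_top_of_le_ne_top hfin (measure_mono sdiff_subset)))
  have hintD : Integrable (D.indicator (1 : EuclideanSpace ℝ (Fin n) → ℝ)) volume :=
    (integrable_indicator_iff hDm).2 (integrableOn_const hDfin)
  have hpt : ∀ x ∈ E, A.indicator (1 : EuclideanSpace ℝ (Fin n) → ℝ) x ≤
      (ψ x - ψ (x + h)) + (D.indicator 1 x + D.indicator 1 (x + h)) := by
    intro x hx
    have hψE : ∀ y ∈ E, y ∉ D → ψ y = 1 := fun y hy hyD =>
      hψK y (by_contra fun hyK => hyD ⟨hEU hy, hyK⟩)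
    have hψE' : ∀ y ∉ E, y ∉ D → ψ y = 0 := fun y hy hyD =>
      hψU y fun hyU => hyD ⟨hyU, fun hyK => hy (hKE hyK)⟩
    obtain ⟨h1, h1'⟩ := hψ01 x
    obtain ⟨h2, h2'⟩ := hψ01 (x + h)
    have h3 := hψE x hx
    have h4 := hψE (x + h)
    have h5 := hψE' (x + h)
    have hAx : x ∈ A ↔ x + h ∉ E := by simp [hA, hx]
    classical
    simp only [indicator_apply, hAx, Pi.one_apply]
    split_ifs <;> first | linarith | simp_all
  have hreal : volume.real A ≤ (∫ x in E, (ψ x - ψ (x + h))) + δ := by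
    have hle : ∀ f : EuclideanSpace ℝ (Fin n) → ℝ, Integrable f → (∀ x, 0 ≤ f x) →
        ∫ x in E, f x ≤ ∫ x, f x := fun f hf h0 =>
      setIntegral_le_integral hf (Eventually.of_forall h0)
    have hD0 : ∀ x, 0 ≤ D.indicator (1 : EuclideanSpace ℝ (Fin n) → ℝ) x :=
      indicator_nonneg fun _ _ => zero_le_one
    have hDint : ∫ x, D.indicator (1 : EuclideanSpace ℝ (Fin n) → ℝ) x = volume.real D :=
      integral_indicator_one hDm
    have hi1 : Integrable (fun x => ψ x - ψ (x + h)) (volume.restrict E) :=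
      (hint.sub (hint.comp_add_right h)).restrict
    have hi2 : Integrable (fun x => D.indicator (1 : EuclideanSpace ℝ (Fin n) → ℝ) (x + h))
        (volume.restrict E) := (hintD.comp_add_right h).restrict
    have hi3 : Integrable (fun x => D.indicator (1 : EuclideanSpace ℝ (Fin n) → ℝ) x +
        D.indicator (1 : EuclideanSpace ℝ (Fin n) → ℝ) (x + h)) (volume.restrict E) :=
      hintD.restrict.add hi2
    calc volume.real A = ∫ x in E, A.indicator (1 : EuclideanSpace ℝ (Fin n) → ℝ) x := by
          rw [integral_indicator_one hAm, measureReal_restrict_apply hAm,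
            inter_eq_left.2 sdiff_subset]
      _ ≤ ∫ x in E, ((ψ x - ψ (x + h)) + (D.indicator 1 x + D.indicator 1 (x + h))) :=
          setIntegral_mono_on hintA.integrableOn (hi1.add hi3) hE hpt
      _ = (∫ x in E, (ψ x - ψ (x + h))) + ((∫ x in E, D.indicator 1 x) +
            ∫ x in E, D.indicator 1 (x + h)) := by
          rw [integral_add hi1 hi3, integral_add hintD.restrict hi2]
      _ ≤ (∫ x in E, (ψ x - ψ (x + h))) + (δ / 2 + δ / 2) := by
          gcongr
          · exact ((hle _ hintD hD0).trans hDint.le).trans hDreal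
          · refine ((hle _ (hintD.comp_add_right h) fun x => hD0 _).trans ?_).trans hDreal
            rw [integral_add_right_eq_self (fun x => D.indicator 1 x), hDint]
      _ = _ := by ring
  calc volume A = ENNReal.ofReal (volume.real A) :=
        (ofReal_measureReal (ne_top_of_le_ne_top hfin (measure_mono sdiff_subset))).symm
    _ ≤ ENNReal.ofReal (∫ x in E, (ψ x - ψ (x + h))) + δ := by
        refine (ENNReal.ofReal_le_ofReal hreal).trans (ENNReal.ofReal_add_le.trans ?_)
        simp
    _ ≤ ‖h‖ₑ * perimeter E + δ := by
        gcongr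
        exact ofReal_setIntegral_sub_translate_le E hψ hψc
          (fun x => abs_le.2 ⟨by linarith [(hψ01 x).1], (hψ01 x).2⟩) h

/-! ### Mollified indicator functions -/

section Kernel

variable {G : Type*} [NormedAddCommGroup G] [NormedSpace ℝ G] [FiniteDimensional ℝ G]
  [MeasurableSpace G] [BorelSpace G]

/-- Lipschitz mollifying kernels supported in a small ball. -/
theorem exists_lipschitz_kernel (μ : Measure G) [μ.IsAddHaarMeasure] {ε : ℝ} (hε : 0 < ε) :
    ∃ (r : G → ℝ≥0∞) (L : NNReal), Measurable r ∧ ∫⁻ x, r x ∂μ = 1 ∧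
      (∀ x, r x ≠ 0 → ‖x‖ₑ ≤ ENNReal.ofReal ε) ∧ ∀ x y, r x ≤ r y + L * ‖x - y‖ₑ := by
  let φ : ContDiffBump (0 : G) := ⟨ε / 2, ε, half_pos hε, half_lt_self hε⟩
  have hφ : ContDiff ℝ 1 (φ.normed μ) := φ.contDiff_normed (n := 1)
  obtain ⟨L, hL⟩ : ∃ L, LipschitzWith L (φ.normed μ) :=
    hφ.lipschitzWith_of_hasCompactSupport φ.hasCompactSupport_normed one_ne_zero
  refine ⟨fun x => ENNReal.ofReal (φ.normed μ x), L,
    φ.continuous_normed.measurable.ennreal_ofReal, ?_, fun x hx => ?_, fun x y => ?_⟩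
  · rw [← ofReal_integral_eq_lintegral_ofReal φ.integrable_normed
      (Eventually.of_forall φ.nonneg_normed), φ.integral_normed, ENNReal.ofReal_one]
  · have h : x ∈ Function.support (φ.normed μ) := fun h0 => hx (by simp [h0])
    rw [φ.support_normed_eq, mem_ball_zero_iff] at h
    rw [← ofReal_norm]
    exact ENNReal.ofReal_le_ofReal h.le
  · have h := hL.dist_le_mul x y
    have h1 : φ.normed μ x ≤ φ.normed μ y + L * ‖x - y‖ := by
      rw [Real.dist_eq, dist_eq_norm] at h
      linarith [le_abs_self (φ.normed μ x - φ.normed μ y)]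
    refine (ENNReal.ofReal_le_ofReal h1).trans (ENNReal.ofReal_add_le.trans ?_)
    rw [ENNReal.ofReal_mul L.coe_nonneg, ENNReal.ofReal_coe_nnreal, ofReal_norm]

end Kernel

variable {n : ℕ}

/-- The mollification `x ↦ ∫_E r(x - y) dy` of the indicator function of `E`. -/
noncomputable def mollify (r : EuclideanSpace ℝ (Fin n) → ℝ≥0∞)
    (E : Set (EuclideanSpace ℝ (Fin n))) (x : EuclideanSpace ℝ (Fin n)) : ℝ≥0∞ :=
  ∫⁻ y in E, r (x - y)

theorem measurable_mollify {r : EuclideanSpace ℝ (Fin n) → ℝ≥0∞} (hr : Measurable r)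
    (E : Set (EuclideanSpace ℝ (Fin n))) : Measurable (mollify r E) :=
  Measurable.lintegral_prod_right' (f := fun p : EuclideanSpace ℝ (Fin n) × _ => r (p.1 - p.2))
    (by fun_prop)

theorem mollify_le_add {r : EuclideanSpace ℝ (Fin n) → ℝ≥0∞} {L : NNReal}
    (hL : ∀ x y, r x ≤ r y + L * ‖x - y‖ₑ)
    {E : Set (EuclideanSpace ℝ (Fin n))} (hvol : volume E = 1) (x y : EuclideanSpace ℝ (Fin n)) :
    mollify r E x ≤ mollify r E y + L * ‖x - y‖ₑ := by
  calc mollify r E x ≤ ∫⁻ z in E, (r (y - z) + L * ‖x - y‖ₑ) :=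
        lintegral_mono fun z => by simpa using hL (x - z) (y - z)
    _ = mollify r E y + L * ‖x - y‖ₑ := by
        rw [lintegral_add_right _ measurable_const]
        simp [mollify, hvol]

theorem lintegral_mollify {r : EuclideanSpace ℝ (Fin n) → ℝ≥0∞} (hr : Measurable r)
    (hr1 : ∫⁻ x, r x = 1) {E : Set (EuclideanSpace ℝ (Fin n))} (hvol : volume E = 1) :
    ∫⁻ x, mollify r E x = 1 := by
  simp only [mollify]
  rw [lintegral_lintegral_swap (by fun_prop)]
  simp [lintegral_sub_right_eq_self r, hr1, hvol]

/-- The mass that mollification at scale `ε` moves out of `E` is at most `ε` times the perimeter: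
it is an average over `‖h‖ ≤ ε` of the volumes of the parts of `E` that leave `E` under translation
by `h`. -/
theorem setLIntegral_compl_mollify_le {r : EuclideanSpace ℝ (Fin n) → ℝ≥0∞} (hr : Measurable r)
    (hr1 : ∫⁻ x, r x = 1) {ε : ℝ} (hrε : ∀ x, r x ≠ 0 → ‖x‖ₑ ≤ ENNReal.ofReal ε)
    {E : Set (EuclideanSpace ℝ (Fin n))} (hE : MeasurableSet E) (hfin : volume E ≠ ∞) :
    ∫⁻ x in Eᶜ, mollify r E x ≤ ENNReal.ofReal ε * perimeter E := by
  have hinner : ∀ h, ∫⁻ y in E, r h * Eᶜ.indicator 1 (y + h) =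
      r h * volume (E \ (· + h) ⁻¹' E) := by
    intro h
    have hm : MeasurableSet ((· + h) ⁻¹' Eᶜ) := hE.compl.preimage (measurable_add_const h)
    have h1 : (fun y => Eᶜ.indicator (1 : EuclideanSpace ℝ (Fin n) → ℝ≥0∞) (y + h)) =
        ((· + h) ⁻¹' Eᶜ).indicator 1 := rfl
    have h2 : Measurable fun y =>
        Eᶜ.indicator (1 : EuclideanSpace ℝ (Fin n) → ℝ≥0∞) (y + h) :=
      (measurable_one.indicator hE.compl).comp (measurable_add_const h)
    rw [lintegral_const_mul _ h2, h1, lintegral_indicator_one hm, Measure.restrict_apply hm, inter_comm]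
    rfl
  have hmeas : Measurable fun p : EuclideanSpace ℝ (Fin n) × EuclideanSpace ℝ (Fin n) =>
      r p.2 * Eᶜ.indicator (1 : EuclideanSpace ℝ (Fin n) → ℝ≥0∞) (p.1 + p.2) :=
    (hr.comp measurable_snd).mul ((measurable_one.indicator hE.compl).comp (by fun_prop))
  calc ∫⁻ x in Eᶜ, mollify r E x
      = ∫⁻ x, ∫⁻ y in E, r (x - y) * Eᶜ.indicator 1 x := by
        rw [← lintegral_indicator hE.compl]
        refine lintegral_congr fun x => ?_
        by_cases hx : x ∈ Eᶜ <;> simp [mollify, hx]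
    _ = ∫⁻ y in E, ∫⁻ x, r (x - y) * Eᶜ.indicator 1 x := by
        refine lintegral_lintegral_swap (Measurable.aemeasurable ?_)
        exact (hr.comp (measurable_fst.sub measurable_snd)).mul
          ((measurable_one.indicator hE.compl).comp measurable_fst)
    _ = ∫⁻ y in E, ∫⁻ h, r h * Eᶜ.indicator 1 (y + h) := by
        refine lintegral_congr fun y => ?_
        rw [← lintegral_add_left_eq_self _ y]
        simp
    _ = ∫⁻ h, ∫⁻ y in E, r h * Eᶜ.indicator 1 (y + h) :=
        lintegral_lintegral_swap hmeas.aemeasurable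
    _ = ∫⁻ h, r h * volume (E \ (· + h) ⁻¹' E) := lintegral_congr hinner
    _ ≤ ∫⁻ h, r h * (ENNReal.ofReal ε * perimeter E) := by
        refine lintegral_mono fun h => ?_
        rcases eq_or_ne (r h) 0 with h0 | h0
        · simp [h0]
        · gcongr
          refine (volume_diff_translate_le hE hfin h).trans ?_
          gcongr
          exact hrε h h0
    _ = ENNReal.ofReal ε * perimeter E := by
        rw [lintegral_mul_const _ hr, hr1, one_mul]

theorem perimeter_congr_ae {E E' : Set (EuclideanSpace ℝ (Fin n))} (h : E =ᵐ[volume] E') :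
    perimeter E = perimeter E' := by
  simp only [perimeter, Measure.restrict_congr_set h]

/-! ### Perimeter against transport cost -/

/-- The quantitative trade-off between perimeter and transport cost: testing a coupling with the
mollified indicator function of `E`, which is nearly `1` on `E` and nearly `0` on `F`. -/
theorem exists_one_le_perimeter_add_lintegral (n : ℕ) {ε : ℝ} (hε : 0 < ε) :
    ∃ L : NNReal, ∀ E F : Set (EuclideanSpace ℝ (Fin n)), IsAdmissiblePair E F →
      ∀ γ ∈ couplings (volume.restrict E) (volume.restrict F),
        1 ≤ 2 * (ENNReal.ofReal ε * perimeter E) + L * ∫⁻ z, ‖z.1 - z.2‖ₑ ∂γ := by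
  obtain ⟨r, L, hr, hr1, hrε, hL⟩ :=
    exists_lipschitz_kernel (volume : Measure (EuclideanSpace ℝ (Fin n))) hε
  refine ⟨L, fun E₀ F hEF γ hγ => ?_⟩
  obtain ⟨E, hE, hEE⟩ := hEF.measurable_left.exists_measurable_superset_ae_eq.imp
    fun _ h => h.2
  have hvol : volume E = 1 := (measure_congr hEE).trans hEF.volume_left
  have hfst : γ.map Prod.fst = volume.restrict E :=
    hγ.2.1.trans (Measure.restrict_congr_set hEE).symm
  rw [perimeter_congr_ae hEE.symm]
  have hout := setLIntegral_compl_mollify_le hr hr1 hrε hE (by simp [hvol])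
  have hm := measurable_mollify hr E
  have hF : ∫⁻ x in F, mollify r E x ≤ ∫⁻ x in Eᶜ, mollify r E x := by
    refine lintegral_mono_set' ?_
    have h0 : volume (E ∩ F) = 0 :=
      (measure_congr (hEE.inter (ae_eq_refl F))).trans hEF.inter_null
    filter_upwards [measure_eq_zero_iff_ae_notMem.1 h0] with x hx hxF hxE
    exact hx ⟨hxE, hxF⟩
  have hE' : ∫⁻ x in E, mollify r E x ≤
      (∫⁻ x in F, mollify r E x) + L * ∫⁻ z, ‖z.1 - z.2‖ₑ ∂γ := by
    rw [← hfst, ← hγ.2.2, lintegral_map hm measurable_fst, lintegral_map hm measurable_snd,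
      ← lintegral_const_mul _ (by fun_prop),
      ← lintegral_add_left (f := fun z : EuclideanSpace ℝ (Fin n) × _ => mollify r E z.2)
        (hm.comp measurable_snd)]
    exact lintegral_mono fun z => mollify_le_add hL hvol z.1 z.2
  calc (1 : ℝ≥0∞) = (∫⁻ x in E, mollify r E x) + ∫⁻ x in Eᶜ, mollify r E x := by
        rw [lintegral_add_compl _ hE, lintegral_mollify hr hr1 hvol]
    _ ≤ (ENNReal.ofReal ε * perimeter E + L * ∫⁻ z, ‖z.1 - z.2‖ₑ ∂γ) +
          ENNReal.ofReal ε * perimeter E :=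
        add_le_add (hE'.trans (add_le_add_left (hF.trans hout) _)) hout
    _ = _ := by ring

/-- Jensen's inequality for the transport cost. -/
theorem lintegral_enorm_sub_le_rpow {p : ℝ} (hp : 1 ≤ p)
    (γ : Measure (EuclideanSpace ℝ (Fin n) × EuclideanSpace ℝ (Fin n))) [IsProbabilityMeasure γ] :
    ∫⁻ z, ‖z.1 - z.2‖ₑ ∂γ ≤ (∫⁻ z, ‖z.1 - z.2‖ₑ ^ p ∂γ) ^ (1 / p) := by
  have hm : Measurable fun z : EuclideanSpace ℝ (Fin n) × EuclideanSpace ℝ (Fin n) => z.1 - z.2 :=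
    by fun_prop
  simpa [eLpNorm'] using eLpNorm'_le_eLpNorm'_of_exponent_le zero_lt_one hp γ
    hm.aestronglyMeasurable

theorem exists_one_le_perimeter_add_wassersteinDist (n : ℕ) {p : ℝ} (hp : 1 ≤ p) {ε : ℝ}
    (hε : 0 < ε) :
    ∃ L : NNReal, ∀ E F : Set (EuclideanSpace ℝ (Fin n)), IsAdmissiblePair E F →
      1 ≤ 2 * (ENNReal.ofReal ε * perimeter E) + L * wassersteinDist p E F := by
  have hp0 : 0 < p := zero_lt_one.trans_le hp
  obtain ⟨L₀, hL₀⟩ := exists_one_le_perimeter_add_lintegral n hε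
  -- A positive constant, so that dividing by it is harmless.
  obtain ⟨L, hL₀L, hL0⟩ : ∃ L, L₀ ≤ L ∧ L ≠ 0 :=
    ⟨L₀ + 1, le_self_add, by positivity⟩
  refine ⟨L, fun E F hEF => ?_⟩
  set P := 2 * (ENNReal.ofReal ε * perimeter E)
  have key : ∀ γ ∈ couplings (volume.restrict E) (volume.restrict F),
      ((1 - P) / L) ^ p ≤ ∫⁻ z, ‖z.1 - z.2‖ₑ ^ p ∂γ := by
    intro γ hγ
    have : IsProbabilityMeasure γ := ⟨by
      have h := congrArg (fun μ => μ univ) hγ.2.1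
      simpa [Measure.map_apply measurable_fst, hEF.volume_left] using h⟩
    have h1 : (1 - P) / L ≤ (∫⁻ z, ‖z.1 - z.2‖ₑ ^ p ∂γ) ^ (1 / p) := by
      refine (ENNReal.div_le_of_le_mul' ?_).trans (lintegral_enorm_sub_le_rpow hp γ)
      refine tsub_le_iff_left.2 ((hL₀ E F hEF γ hγ).trans ?_)
      gcongr
    simpa [← ENNReal.rpow_mul, hp0.ne'] using ENNReal.rpow_le_rpow h1 hp0.le
  have hW : (1 - P) / L ≤ wassersteinDist p E F := by
    have h2 := ENNReal.rpow_le_rpow (le_iInf₂ key) (by positivity : 0 ≤ 1 / p)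
    rwa [← ENNReal.rpow_mul, mul_one_div_cancel hp0.ne', ENNReal.rpow_one] at h2
  rw [ENNReal.div_le_iff_le_mul (Or.inl (ENNReal.coe_ne_zero.2 hL0))
    (Or.inl ENNReal.coe_ne_top), mul_comm] at hW
  exact tsub_le_iff_left.1 hW

theorem wassersteinDist_comm (p : ℝ) (E F : Set (EuclideanSpace ℝ (Fin n))) :
    wassersteinDist p E F = wassersteinDist p F E := by
  have h : ∀ E F : Set (EuclideanSpace ℝ (Fin n)),
      kantorovich (fun x y => ‖x - y‖ₑ ^ p) (volume.restrict E) (volume.restrict F) ≤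
        kantorovich (fun x y => ‖x - y‖ₑ ^ p) (volume.restrict F) (volume.restrict E) := by
    intro E F
    refine le_iInf₂ fun γ hγ => ?_
    have := hγ.1
    have hmem : γ.map Prod.swap ∈ couplings (volume.restrict E) (volume.restrict F) := by
      refine ⟨inferInstance, ?_, ?_⟩
      · rw [Measure.map_map measurable_fst measurable_swap]
        exact hγ.2.2
      · rw [Measure.map_map measurable_snd measurable_swap]
        exact hγ.2.1
    refine (iInf₂_le _ hmem).trans ?_
    rw [lintegral_map (by fun_prop) measurable_swap]
    refine (lintegral_congr fun z => ?_).le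
    simp only [Prod.fst_swap, Prod.snd_swap]
    rw [← enorm_neg, neg_sub]
  rw [wassersteinDist, wassersteinDist, le_antisymm (h E F) (h F E)]

theorem IsAdmissiblePair.symm {E F : Set (EuclideanSpace ℝ (Fin n))} (h : IsAdmissiblePair E F) :
    IsAdmissiblePair F E :=
  ⟨h.measurable_right, h.measurable_left, inter_comm E F ▸ h.inter_null, h.volume_right,
    h.volume_left⟩

theorem tendsto_perimeter {p : ℝ} (hp : 1 ≤ p) {E F : ℕ → Set (EuclideanSpace ℝ (Fin n))}
    (hEF : ∀ m, IsAdmissiblePair (E m) (F m))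
    (hW : Tendsto (fun m => wassersteinDist p (E m) (F m)) atTop (𝓝 0)) :
    Tendsto (fun m => perimeter (E m)) atTop (𝓝 ∞) := by
  refine ENNReal.tendsto_nhds_top fun M => ?_
  -- For this scale, `P(E) ≤ M` would make the perimeter term at most `1 / 2`.
  have hε : (0 : ℝ) < 1 / (4 * (M + 1)) := by positivity
  obtain ⟨L, hL⟩ := exists_one_le_perimeter_add_wassersteinDist n hp hε
  have hLW : Tendsto (fun m => L * wassersteinDist p (E m) (F m)) atTop (𝓝 0) := by
    simpa using ENNReal.Tendsto.const_mul hW (Or.inr (ENNReal.coe_ne_top (r := L)))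
  filter_upwards [hLW.eventually_lt_const (by simp : (0 : ℝ≥0∞) < 1 / 2)] with m hm
  by_contra! hle
  have hP : 2 * (ENNReal.ofReal (1 / (4 * (M + 1))) * perimeter (E m)) ≤ 1 / 2 := by
    calc 2 * (ENNReal.ofReal (1 / (4 * (M + 1))) * perimeter (E m))
        ≤ ENNReal.ofReal 2 * (ENNReal.ofReal (1 / (4 * (M + 1))) * ENNReal.ofReal M) := by
          gcongr <;> simp [hle]
      _ = ENNReal.ofReal (2 * (1 / (4 * (M + 1)) * M)) := by
          rw [← ENNReal.ofReal_mul hε.le, ← ENNReal.ofReal_mul zero_le_two]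
      _ ≤ ENNReal.ofReal (1 / 2) := by
          refine ENNReal.ofReal_le_ofReal ?_
          have hM : (0 : ℝ) < M + 1 := by positivity
          rw [one_div_mul_eq_div, mul_div_assoc', div_le_div_iff₀ (by positivity) zero_lt_two]
          linarith
      _ = 1 / 2 := by
          rw [ENNReal.ofReal_div_of_pos zero_lt_two]
          simp
  refine absurd (hL _ _ (hEF m)) (not_le.2 ?_)
  calc _ < (1 / 2 : ℝ≥0∞) + 1 / 2 := ENNReal.add_lt_add_of_le_of_lt
        (ne_top_of_le_ne_top (by simp) hP) hP hm
    _ = 1 := ENNReal.add_halves 1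

/-! ### Stripes -/

/-- Displacing a set by a vector is a coupling, so it bounds the Wasserstein distance. -/
theorem wassersteinDist_preimage_le {n : ℕ} {p : ℝ} (hp : 1 ≤ p)
    {F : Set (EuclideanSpace ℝ (Fin n))} (hF : MeasurableSet F) (hvol : volume F = 1)
    (v : EuclideanSpace ℝ (Fin n)) :
    wassersteinDist p ((· + v) ⁻¹' F) F ≤ ‖v‖ₑ := by
  have hp0 : 0 < p := zero_lt_one.trans_le hp
  set E := (· + v) ⁻¹' F
  have hE : volume E = 1 := by rw [measure_preimage_add_right, hvol]
  have hT : Measurable fun x : EuclideanSpace ℝ (Fin n) => (x, x + v) := by fun_prop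
  have hmem : (volume.restrict E).map (fun x => (x, x + v)) ∈
      couplings (volume.restrict E) (volume.restrict F) := by
    refine ⟨⟨?_⟩, ?_, ?_⟩
    · rw [Measure.map_apply hT MeasurableSet.univ]
      simp [hE]
    · rw [Measure.map_map measurable_fst hT]
      exact Measure.map_id
    · rw [Measure.map_map measurable_snd hT]
      exact ((measurePreserving_add_right volume v).restrict_preimage hF).map_eq
  have hcost : kantorovich (fun x y => ‖x - y‖ₑ ^ p) (volume.restrict E) (volume.restrict F) ≤
      ‖v‖ₑ ^ p := by
    refine (iInf₂_le _ hmem).trans ?_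
    rw [lintegral_map (by fun_prop) hT]
    simp [hE]
  calc wassersteinDist p E F ≤ (‖v‖ₑ ^ p) ^ (1 / p) :=
        ENNReal.rpow_le_rpow hcost (by positivity)
    _ = ‖v‖ₑ := by rw [← ENNReal.rpow_mul, mul_one_div_cancel hp0.ne', ENNReal.rpow_one]

section Stripes

variable {n : ℕ} (i₀ : Fin n)

/-- The box in `ℝⁿ` with side `[0, 2)` in the direction `i₀` and sides `[0, 1)` in the others. -/
def stripedBox : Set (EuclideanSpace ℝ (Fin n)) :=
  {x | ∀ i, x i ∈ Ico (0 : ℝ) (if i = i₀ then 2 else 1)}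

/-- The union of every second one of the `2k` slabs of width `1 / k` that make up the box: those
with an even index for `b = false`, those with an odd index for `b = true`. -/
def stripes (k : ℕ) (b : Bool) : Set (EuclideanSpace ℝ (Fin n)) :=
  stripedBox i₀ ∩ {x | decide (Odd ⌊(k : ℝ) * x i₀⌋) = b}

theorem measurableSet_stripedBox : MeasurableSet (stripedBox i₀) := by
  simp only [stripedBox, ofPred_forall]
  refine MeasurableSet.iInter fun i => measurableSet_Ico.preimage ?_
  fun_prop

theorem measurableSet_stripes (k : ℕ) (b : Bool) : MeasurableSet (stripes i₀ k b) := by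
  refine (measurableSet_stripedBox i₀).inter ?_
  have hf : Measurable fun x : EuclideanSpace ℝ (Fin n) => ⌊(k : ℝ) * x i₀⌋ :=
    Int.measurable_floor.comp (by fun_prop)
  exact hf (MeasurableSet.of_discrete (s := {z : ℤ | decide (Odd z) = b}))

theorem volume_stripedBox : volume (stripedBox i₀) = 2 := by
  have h : stripedBox i₀ = WithLp.ofLp ⁻¹'
      (univ.pi fun i => Ico (0 : ℝ) (if i = i₀ then 2 else 1)) := by
    ext x
    simp [stripedBox]
  rw [h, (PiLp.volume_preserving_ofLp (Fin n)).measure_preimage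
    (MeasurableSet.univ_pi fun i => measurableSet_Ico).nullMeasurableSet, Real.volume_pi_Ico,
    Finset.prod_eq_single i₀]
  · simp
  · intro i _ hi
    simp [hi]
  · simp

theorem stripes_false_eq_preimage {k : ℕ} (hk : 0 < k) :
    stripes i₀ k false =
      (· + EuclideanSpace.single i₀ (1 / (k : ℝ))) ⁻¹' stripes i₀ k true := by
  have hk' : (0 : ℝ) < k := Nat.cast_pos.2 hk
  ext x
  have hfl : ⌊(k : ℝ) * (x i₀ + 1 / k)⌋ = ⌊(k : ℝ) * x i₀⌋ + 1 := by
    rw [mul_add, mul_one_div_cancel hk'.ne', Int.floor_add_one]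
  have hodd : Odd (⌊(k : ℝ) * x i₀⌋ + 1) ↔ ¬ Odd ⌊(k : ℝ) * x i₀⌋ := by
    rw [Int.odd_add, ← Int.not_even_iff_odd, iff_false_right (by decide : ¬ Even (1 : ℤ))]
  simp only [stripes, mem_inter_iff, mem_preimage, stripedBox, mem_ofPred_eq, PiLp.add_apply,
    PiLp.single_apply, if_true, hfl, hodd, decide_eq_true_eq, decide_eq_false_iff_not]
  refine and_congr_left fun hpar => forall_congr' fun i => ?_
  rcases eq_or_ne i i₀ with rfl | hi
  swap
  · simp [hi]
  simp only [if_true, mem_Ico]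
  have hev : Even ⌊(k : ℝ) * x i⌋ := Int.not_odd_iff_even.1 hpar
  obtain ⟨j, hj⟩ := hev
  have h1 := Int.floor_le ((k : ℝ) * x i)
  have h2 := Int.lt_floor_add_one ((k : ℝ) * x i)
  rw [hj] at h1 h2
  push_cast at h1 h2
  have e1 : (k : ℝ) * (1 / k) = 1 := mul_one_div_cancel hk'.ne'
  constructor
  · rintro ⟨h0, h3⟩
    refine ⟨by positivity, ?_⟩
    -- The index `2j` is even and less than `2k`, so that `2j + 1` is still less than `2k`.
    have h4 : (j : ℝ) + j < 2 * k := by nlinarith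
    have h5 : j + j < 2 * (k : ℤ) := by exact_mod_cast h4
    have h6 : j + 1 ≤ (k : ℤ) := by omega
    have h7 : (j : ℝ) + 1 ≤ k := by exact_mod_cast h6
    refine lt_of_mul_lt_mul_left ?_ hk'.le
    rw [mul_add, e1]
    linarith
  · rintro ⟨h0, h3⟩
    have hpos : 0 < 1 / (k : ℝ) := by positivity
    refine ⟨?_, by linarith⟩
    have h4 : (0 : ℝ) < j + j + 2 := by nlinarith
    have h5 : (0 : ℤ) < j + j + 2 := by exact_mod_cast h4
    have h6 : (0 : ℤ) ≤ j := by omega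
    have h7 : (0 : ℝ) ≤ j := by exact_mod_cast h6
    refine le_of_mul_le_mul_left ?_ hk'
    linarith

theorem disjoint_stripes (k : ℕ) : Disjoint (stripes i₀ k false) (stripes i₀ k true) := by
  refine disjoint_left.2 fun x h1 h2 => ?_
  have := h1.2.symm.trans h2.2
  contradiction

theorem volume_stripes_true {k : ℕ} (hk : 0 < k) : volume (stripes i₀ k true) = 1 := by
  have hU : stripes i₀ k false ∪ stripes i₀ k true = stripedBox i₀ := by
    rw [stripes, stripes, ← inter_union_distrib_left, inter_eq_left]
    intro x _
    rcases h : decide (Odd ⌊(k : ℝ) * x i₀⌋)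
    · exact Or.inl h
    · exact Or.inr h
  have h := measure_union (μ := volume) (disjoint_stripes i₀ k) (measurableSet_stripes i₀ k true)
  rw [hU, volume_stripedBox, stripes_false_eq_preimage i₀ hk, measure_preimage_add_right,
    ← two_mul] at h
  exact ((ENNReal.mul_eq_left two_ne_zero ENNReal.ofNat_ne_top).1 h.symm)

theorem volume_stripes_false {k : ℕ} (hk : 0 < k) : volume (stripes i₀ k false) = 1 := by
  rw [stripes_false_eq_preimage i₀ hk, measure_preimage_add_right, volume_stripes_true i₀ hk]

theorem isAdmissiblePair_stripes {k : ℕ} (hk : 0 < k) :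
    IsAdmissiblePair (stripes i₀ k false) (stripes i₀ k true) where
  measurable_left := (measurableSet_stripes i₀ k false).nullMeasurableSet
  measurable_right := (measurableSet_stripes i₀ k true).nullMeasurableSet
  inter_null := by rw [(disjoint_stripes i₀ k).inter_eq, measure_empty]
  volume_left := volume_stripes_false i₀ hk
  volume_right := volume_stripes_true i₀ hk

theorem wassersteinDist_stripes_le {p : ℝ} (hp : 1 ≤ p) {k : ℕ} (hk : 0 < k) :
    wassersteinDist p (stripes i₀ k false) (stripes i₀ k true) ≤ ENNReal.ofReal (1 / k) := by
  rw [stripes_false_eq_preimage i₀ hk]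
  refine (wassersteinDist_preimage_le hp (measurableSet_stripes i₀ k true)
    (volume_stripes_true i₀ hk) _).trans ?_
  rw [← ofReal_norm, PiLp.norm_single, Real.norm_of_nonneg (by positivity)]

theorem tendsto_wassersteinDist_stripes {p : ℝ} (hp : 1 ≤ p) :
    Tendsto (fun m : ℕ => wassersteinDist p (stripes i₀ (m + 1) false) (stripes i₀ (m + 1) true))
      atTop (𝓝 0) := by
  have h : Tendsto (fun m : ℕ => ENNReal.ofReal (1 / ((m + 1 : ℕ) : ℝ))) atTop (𝓝 0) := by
    simpa using ENNReal.tendsto_ofReal (tendsto_one_div_add_atTop_nhds_zero_nat (𝕜 := ℝ))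
  exact tendsto_of_tendsto_of_tendsto_of_le_of_le tendsto_const_nhds h (fun _ => zero_le)
    fun m => wassersteinDist_stripes_le i₀ hp m.succ_pos

end Stripes

end WassersteinPerimeter

theorem lemma2p8 (n : ℕ) (hn : 1 ≤ n) (p : ℝ) (hp : 1 ≤ p) :
    (∃ E F : ℕ → Set (EuclideanSpace ℝ (Fin n)),
      (∀ m, WassersteinPerimeter.IsAdmissiblePair (E m) (F m)) ∧
      Tendsto (fun m => WassersteinPerimeter.wassersteinDist p (E m) (F m)) atTop (𝓝 0)) ∧
    (∀ E F : ℕ → Set (EuclideanSpace ℝ (Fin n)),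
      (∀ m, WassersteinPerimeter.IsAdmissiblePair (E m) (F m)) →
      Tendsto (fun m => WassersteinPerimeter.wassersteinDist p (E m) (F m)) atTop (𝓝 0) →
      Tendsto (fun m => WassersteinPerimeter.perimeter (E m)) atTop (𝓝 ∞) ∧
      Tendsto (fun m => WassersteinPerimeter.perimeter (F m)) atTop (𝓝 ∞)) := by
  refine ⟨⟨fun m => WassersteinPerimeter.stripes ⟨0, hn⟩ (m + 1) false,
    fun m => WassersteinPerimeter.stripes ⟨0, hn⟩ (m + 1) true,
    fun m => WassersteinPerimeter.isAdmissiblePair_stripes _ m.succ_pos,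
    WassersteinPerimeter.tendsto_wassersteinDist_stripes _ hp⟩, fun E F hEF hW => ⟨?_, ?_⟩⟩
  · exact WassersteinPerimeter.tendsto_perimeter hp hEF hW
  · refine WassersteinPerimeter.tendsto_perimeter hp (fun m => (hEF m).symm) ?_
    simpa only [WassersteinPerimeter.wassersteinDist_comm] using hW
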